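/- Let $E$ be a closed subset of the unit circle $\mathbb{T}$ of Lebesgue measure zero. Then there exists a sequence $(u_n)$ of positive real numbers with $u_n\to\infty$ with the following property. Let $\mathcal{F},\mathcal{F}'$ be complex Hilbert spaces with $\mathcal{F}\ne\{0\}$, let $\mathcal{L}(\mathcal{F},\mathcal{F}')$ be the space of bounded linear operators from $\mathcal{F}$ to $\mathcal{F}'$, and let $\Theta:(\mathbb{C}\cup\{\infty\})\setminus E\to\mathcal{L}(\mathcal{F},\mathcal{F}')$ be a holomorphic function on the complement of $E$ in the Riemann sphere. Suppose that $\Theta(\lambda)$ is purely contractive for every $\lambda$ in the open unit disk $\mathbb{D}$, i.e. $\|\Theta(\lambda)x\|<\|x\|$ for all $x\in\mathcal{F}\setminus\{0\}$, and that $\Theta(\lambda)$ is unitary for every $\lambda\in\mathbb{T}\setminus E$. Then $\Theta(\lambda)$ is invertible for every $\lambda\in\mathbb{D}$, and \[ \liminf_{n\to\infty}u_n\,\delta_n(\Theta)=0, \qquad\text{where}\qquad \delta_n(\Theta):=\inf_{\lambda\in\mathbb{D}}\max\bigl\{|\lambda|^n,\ \|\Theta(\lambda)^{-1}\|^{-1}\bigr\}.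 \] -/

import Mathlib

open MeasureTheory Filter Set
open scoped Topology

namespace InnerFn

noncomputable section

/-- Lebesgue (arc length) measure on the unit circle, regarded as a measure on `ℂ` carried by
the circle. -/
def circleLebesgue : Measure ℂ :=
  (volume.restrict (Ioc (-Real.pi) Real.pi)).map (fun θ : ℝ => Complex.exp (θ * Complex.I))

/-- The parametrization `w ↦ 1 / w` of a neighbourhood of `∞` in the Riemann sphere
`ℂ ∪ {∞}`, with `0 ↦ ∞`. -/
def chartInfty (w : ℂ) : OnePoint ℂ :=
  if w = 0 then OnePoint.infty else ((w⁻¹ : ℂ) : OnePoint ℂ)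

/-- A function on an open subset `U` of the Riemann sphere `OnePoint ℂ` with values in a complex
normed space is holomorphic if it is complex differentiable in the two standard coordinates `z`
and `w = 1 / z`. -/
def HolomorphicOnSphere {X : Type*} [NormedAddCommGroup X] [NormedSpace ℂ X]
    (f : OnePoint ℂ → X) (U : Set (OnePoint ℂ)) : Prop :=
  DifferentiableOn ℂ (fun z : ℂ => f (z : OnePoint ℂ)) {z : ℂ | (z : OnePoint ℂ) ∈ U} ∧
    DifferentiableOn ℂ (fun w : ℂ => f (chartInfty w)) {w : ℂ | chartInfty w ∈ U}

section Operators

variable {F F' : Type*} [NormedAddCommGroup F] [InnerProductSpace ℂ F]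
  [NormedAddCommGroup F'] [InnerProductSpace ℂ F']

/-- `‖T x‖ < ‖x‖` for all nonzero `x`. -/
def PurelyContractive (T : F →L[ℂ] F') : Prop :=
  ∀ x : F, x ≠ 0 → ‖T x‖ < ‖x‖

/-- A unitary operator between two Hilbert spaces: `T* T = I` and `T T* = I`. -/
def IsUnitaryOp [CompleteSpace F] [CompleteSpace F'] (T : F →L[ℂ] F') : Prop :=
  (ContinuousLinearMap.adjoint T) ∘L T = ContinuousLinearMap.id ℂ F ∧
    T ∘L (ContinuousLinearMap.adjoint T) = ContinuousLinearMap.id ℂ F'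

/-- `δ_n(Θ) = inf_{|z| < 1} max (|z| ^ n, ‖Θ(z)⁻¹‖⁻¹)`.
The inverse is the usual one whenever `Θ z` is invertible. -/
def delta (Θ : OnePoint ℂ → F →L[ℂ] F') (n : ℕ) : ℝ :=
  ⨅ z : Metric.ball (0 : ℂ) 1,
    max (‖(z : ℂ)‖ ^ n) ‖ContinuousLinearMap.inverse (Θ ((z : ℂ) : OnePoint ℂ))‖⁻¹

end Operators

end

end InnerFn

/-!
The reflection `R(z) = Θ(1 / z̄)*` is holomorphic off `E`, and it inverts `Θ(z)` for `z ∈ 𝕋 \ E`,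
where `Θ(z)` is unitary. By the identity theorem it inverts `Θ(z)` throughout the disk
(`reflection_comp_and_comp_reflection`), so `δ_n(Θ)` measures the growth of `R` at the circle from
inside, while `‖R‖ ≤ 1` off the open disk. If `u n * δ_n(Θ)` stayed above some `c > 0`, then
`‖R(z)‖ ≤ u n / c` as soon as `|z| ^ n ≤ c / u n`, so `R` would grow slowly when `u` does. The point
is that, for `u` growing slowly enough depending on `E` only, this forces `‖R‖ ≤ 1` in the disk
(`norm_le_one_of_slow_growth`). Then `‖x‖ = ‖R(z) Θ(z) x‖ ≤ ‖Θ(z) x‖`, against pure contractivity.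

The Phragmén–Lindelöf principle rests on three facts.

* As `E` is compact and null, for every `k` it is covered by `m_k` disks of a common radius `ρ_k`
  with `m_k ρ_k ≤ (k + 1)⁻²` (`hasZeroContent_of_null`). Adding the functions
  `r / (r + 1 - z ā)`, `r = 2 ρ_k`, over the centres `a` gives a function with nonnegative real
  part, at least `1 / 4` at distance at most `ρ_k` from `E`, and `O(m_k ρ_k)` at a fixed point of the
  disk (`barrier`).
* The sequence `u n = inf_k (k + 1 + ρ_k √n)` tends to infinity (`exists_slow_sequence`), and a
  function whose growth it controls satisfies `s ‖f(z)‖ ≤ (s (k + 1) + 2 ρ_k) / c` for all `k` at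
  once, where `s = 1 - |z|` (`growth_bound`).
* Since `f` is holomorphic across `𝕋 \ E`, growth in terms of the distance to `𝕋` improves to growth
  in terms of the distance to `E`: on a circle of centre `a`, `| |z|² - 1 |` is proportional to the
  modulus of a polynomial (`mul_norm_le_of_weighted_sphere_bound`). So `‖f‖ = O(k)` at distance
  `ρ_k` from `E` (`norm_le_of_infDist_eq`).

The maximum principle for `exp (-k * barrier) • f` on the points of the disk at distance more than
`ρ_k` from `E` then bounds `‖f(z)‖` by `exp (O(k m_k ρ_k)) → 1`.
-/

namespace InnerFn

/-! ### Coverings of null sets by few equal disks -/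

/-- A bounded subset of the line is covered by `m` balls of radius `ρ` centred in it, where `m ρ`
is at most the measure of its closed `ρ`-neighbourhood: use one point in each cell of the grid of
step `ρ` that meets the set. -/
theorem exists_finset_cover_real {S : Set ℝ} (hS : Bornology.IsBounded S) {ρ : ℝ} (hρ : 0 < ρ) :
    ∃ t : Finset ℝ, (∀ y ∈ t, y ∈ S) ∧
      (t.card : ENNReal) * ENNReal.ofReal ρ ≤ volume (Metric.cthickening ρ S) ∧
      ∀ x ∈ S, ∃ y ∈ t, |x - y| ≤ ρ := by
  classical
  have hfin : ((fun x : ℝ => ⌊x / ρ⌋) '' S).Finite := by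
    obtain ⟨R, hR⟩ := hS.subset_closedBall 0
    apply (Set.finite_Icc ⌊-R / ρ⌋ ⌊R / ρ⌋).subset
    rintro _ ⟨x, hx, rfl⟩
    have := hR hx
    rw [Real.closedBall_eq_Icc] at this
    exact ⟨Int.floor_mono (by gcongr; linarith [this.1]),
      Int.floor_mono (by gcongr; linarith [this.2])⟩
  have hsel : ∀ j ∈ hfin.toFinset, ∃ y ∈ S, ⌊y / ρ⌋ = j := by
    intro j hj
    simpa using hj
  choose! y hyS hy using hsel
  -- The cell of index `j` is `[j ρ, (j + 1) ρ)`.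
  have hcell : ∀ (j : ℤ) (x : ℝ), ⌊x / ρ⌋ = j ↔ j * ρ ≤ x ∧ x < (j + 1) * ρ := by
    intro j x
    rw [Int.floor_eq_iff, le_div_iff₀ hρ, div_lt_iff₀ hρ]
  refine ⟨hfin.toFinset.image y, ?_, ?_, ?_⟩
  · intro z hz
    obtain ⟨j, hj, rfl⟩ := Finset.mem_image.1 hz
    exact hyS j hj
  · calc ((hfin.toFinset.image y).card : ENNReal) * ENNReal.ofReal ρ
        ≤ (hfin.toFinset.card : ENNReal) * ENNReal.ofReal ρ := by
          gcongr; exact Finset.card_image_le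
      _ = ∑ j ∈ hfin.toFinset, volume (Ico ((j : ℝ) * ρ) ((j + 1) * ρ)) := by
          simp only [Real.volume_Ico]
          rw [Finset.sum_congr rfl (g := fun _ => ENNReal.ofReal ρ)
            (fun j _ => by congr 1; ring)]
          simp
      _ = volume (⋃ j ∈ hfin.toFinset, Ico ((j : ℝ) * ρ) ((j + 1) * ρ)) := by
          rw [measure_biUnion_finset _ (fun j _ => measurableSet_Ico)]
          intro i _ j _ hij
          refine Set.disjoint_left.2 fun x hxi hxj => hij ?_
          rw [← (hcell i x).2 hxi, ← (hcell j x).2 hxj]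
      _ ≤ volume (Metric.cthickening ρ S) := by
          apply measure_mono
          simp only [Set.iUnion_subset_iff]
          intro j hj x hx
          apply Metric.mem_cthickening_of_dist_le x (y j) ρ S (hyS j hj)
          have h1 := (hcell j (y j)).1 (hy j hj)
          rw [Real.dist_eq, abs_le]
          constructor <;> nlinarith [hx.1, hx.2, h1.1, h1.2]
  · intro x hx
    have hj : ⌊x / ρ⌋ ∈ hfin.toFinset := by simpa using ⟨x, hx, rfl⟩
    refine ⟨_, Finset.mem_image_of_mem y hj, ?_⟩
    have h1 := (hcell _ (y _)).1 (hy _ hj)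
    have h2 := (hcell _ x).1 rfl
    rw [abs_le]
    constructor <;> nlinarith [h1.1, h1.2, h2.1, h2.2]

/-- `E` has zero lower one-dimensional Minkowski content: it is covered by `m` disks of a common
radius `ρ`, centred on the unit circle, with `ρ` and `m ρ` as small as desired. -/
def HasZeroContent (E : Set ℂ) : Prop :=
  ∀ η : ℝ, 0 < η → ∃ ρ : ℝ, 0 < ρ ∧ ρ ≤ η ∧ ∃ A : Finset ℂ,
    (∀ a ∈ A, ‖a‖ = 1) ∧ A.card * ρ ≤ η ∧ ∀ z ∈ E, ∃ a ∈ A, ‖z - a‖ ≤ ρ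

theorem norm_exp_mul_I_sub_le (x y : ℝ) :
    ‖Complex.exp (x * Complex.I) - Complex.exp (y * Complex.I)‖ ≤ |x - y| := by
  have h : Complex.exp (x * Complex.I) - Complex.exp (y * Complex.I)
      = Complex.exp (y * Complex.I) * (Complex.exp (Complex.I * ((x - y : ℝ) : ℂ)) - 1) := by
    rw [mul_sub, ← Complex.exp_add, mul_one]
    congr 2
    push_cast
    ring
  rw [h, norm_mul, Complex.norm_exp_ofReal_mul_I, one_mul]
  simpa using Real.norm_exp_I_mul_ofReal_sub_one_le (x := x - y)

/-- A compact null set has zero content, because the measures of its closed neighbourhoods tend to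
its measure. -/
theorem hasZeroContent_of_null {E : Set ℂ} (hsub : E ⊆ Metric.sphere (0 : ℂ) 1)
    (hcl : IsClosed E) (hnull : circleLebesgue E = 0) : HasZeroContent E := by
  classical
  intro η hη
  have hcont : Continuous fun θ : ℝ => Complex.exp (θ * Complex.I) := by fun_prop
  set S : Set ℝ := Icc (-Real.pi) Real.pi ∩ (fun θ : ℝ => Complex.exp (θ * Complex.I)) ⁻¹' E
    with hSdef
  have hScomp : IsCompact S := isCompact_Icc.inter_right (hcl.preimage hcont)
  have hS0 : volume S = 0 := by
    rw [circleLebesgue, Measure.map_apply hcont.measurable hcl.measurableSet,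
      Measure.restrict_apply (hcl.preimage hcont).measurableSet] at hnull
    -- `S` is cut out of `[-π, π]` to be compact, the measure lives on `(-π, π]`.
    refine measure_mono_null ?_ (measure_union_null (Real.volume_singleton (a := -Real.pi)) hnull)
    rintro x ⟨hx, hxE⟩
    rcases hx.1.eq_or_lt with h | h
    · exact Or.inl h.symm
    · exact Or.inr ⟨hxE, h, hx.2⟩
  have hlim := tendsto_measure_cthickening_of_isCompact (μ := volume) hScomp
  rw [hS0] at hlim
  have hev : ∀ᶠ r in 𝓝[>] (0 : ℝ), volume (Metric.cthickening r S) < ENNReal.ofReal η :=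
    (hlim.mono_left nhdsWithin_le_nhds).eventually
      (gt_mem_nhds (ENNReal.ofReal_pos.2 hη))
  obtain ⟨ρ, ⟨hρ1, hρ2⟩, hρ3⟩ :=
    ((hev.and (Ioc_mem_nhdsGT hη)).exists.imp fun ρ h => ⟨h.2, h.1⟩ :
      ∃ ρ, ρ ∈ Ioc 0 η ∧ volume (Metric.cthickening ρ S) < ENNReal.ofReal η)
  obtain ⟨t, -, htc, ht⟩ := exists_finset_cover_real hScomp.isBounded hρ1
  refine ⟨ρ, hρ1, hρ2, t.image (fun θ : ℝ => Complex.exp (θ * Complex.I)), ?_, ?_, ?_⟩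
  · intro a ha
    obtain ⟨θ, -, rfl⟩ := Finset.mem_image.1 ha
    exact Complex.norm_exp_ofReal_mul_I θ
  · have h1 : (t.card : ℝ) * ρ ≤ η := by
      have h2 := htc.trans hρ3.le
      rw [← ENNReal.ofReal_natCast, ← ENNReal.ofReal_mul (by positivity),
        ENNReal.ofReal_le_ofReal_iff hη.le] at h2
      exact h2
    refine le_trans ?_ h1
    gcongr
    exact Finset.card_image_le
  · intro z hz
    have hz1 : ‖z‖ = 1 := by simpa using hsub hz
    have hzexp : Complex.exp (Complex.arg z * Complex.I) = z := by
      have := Complex.norm_mul_exp_arg_mul_I z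
      rwa [hz1, Complex.ofReal_one, one_mul] at this
    obtain ⟨y, hy, hxy⟩ := ht (Complex.arg z)
      ⟨⟨(Complex.neg_pi_lt_arg z).le, Complex.arg_le_pi z⟩, by
        simpa only [mem_preimage, hzexp] using hz⟩
    refine ⟨_, Finset.mem_image_of_mem _ hy, ?_⟩
    calc _ = ‖Complex.exp (Complex.arg z * Complex.I) - Complex.exp (y * Complex.I)‖ := by
            rw [hzexp]
      _ ≤ _ := (norm_exp_mul_I_sub_le _ _).trans hxy

theorem exists_sphere_notMem_of_circleLebesgue_eq_zero {E : Set ℂ} (hnull : circleLebesgue E = 0) :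
    ∃ p : ℂ, ‖p‖ = 1 ∧ p ∉ E := by
  by_contra! h
  have hcont : Continuous fun θ : ℝ => Complex.exp (θ * Complex.I) := by fun_prop
  have h1 : circleLebesgue (Metric.sphere 0 1) = 0 :=
    measure_mono_null (fun p hp => h p (by simpa using hp)) hnull
  rw [circleLebesgue, Measure.map_apply hcont.measurable Metric.isClosed_sphere.measurableSet]
    at h1
  have h2 : (fun θ : ℝ => Complex.exp (θ * Complex.I)) ⁻¹' Metric.sphere 0 1 = univ := by
    ext θ
    simp [Complex.norm_exp_ofReal_mul_I]
  rw [h2, Measure.restrict_apply_univ, Real.volume_Ioc, ENNReal.ofReal_eq_zero] at h1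
  linarith [Real.pi_pos]

/-! ### A slowly growing sequence -/

/-- The infimum of `k + 1 + ε k * √n` over `k` grows to infinity as slowly as `ε` prescribes. -/
theorem exists_slow_sequence {ε : ℕ → ℝ} (hε : ∀ k, 0 < ε k) :
    ∃ u : ℕ → ℝ, (∀ n, 0 < u n) ∧ Tendsto u atTop atTop ∧
      ∀ k n : ℕ, u n ≤ k + 1 + ε k * √n := by
  have hbdd : ∀ n : ℕ, BddBelow (range fun k : ℕ => (k : ℝ) + 1 + ε k * √n) := by
    intro n
    refine ⟨0, ?_⟩
    rintro _ ⟨k, rfl⟩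
    have := hε k
    positivity
  refine ⟨fun n => ⨅ k : ℕ, ((k : ℝ) + 1 + ε k * √n), fun n => ?_, ?_,
    fun k n => ciInf_le (hbdd n) k⟩
  · refine lt_of_lt_of_le one_pos (le_ciInf fun k => ?_)
    have := mul_nonneg (hε k).le (Real.sqrt_nonneg n)
    have := Nat.cast_nonneg (α := ℝ) k
    linarith
  · refine tendsto_atTop.2 fun B => ?_
    obtain ⟨m, hm⟩ := exists_nat_ge B
    have hsqrt : Tendsto (fun n : ℕ => √(n : ℝ)) atTop atTop :=
      Real.tendsto_sqrt_atTop.comp tendsto_natCast_atTop_atTop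
    have hev : ∀ᶠ n : ℕ in atTop, ∀ k ∈ Finset.range m, B ≤ ε k * √n := by
      rw [Filter.eventually_all_finset]
      exact fun k _ => (hsqrt.const_mul_atTop (hε k)).eventually_ge_atTop B
    filter_upwards [hev] with n hn
    -- The terms of index `k ≥ m` exceed `B` by themselves, the others through `ε k * √n`.
    refine le_ciInf fun k => ?_
    have h0 := mul_nonneg (hε k).le (Real.sqrt_nonneg n)
    have h1 := Nat.cast_nonneg (α := ℝ) k
    by_cases hk : k < m
    · linarith [hn k (Finset.mem_range.2 hk)]
    · have : (m : ℝ) ≤ k := by exact_mod_cast not_lt.1 hk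
      linarith

/-- If `f` is bounded by `u n / c` on the disk `|z| ^ n * u n ≤ c` for all large `n`, then, with
`s = 1 - |z|` and `n ≈ s⁻²`, the bound on `u n` gives a bound on `s * ‖f z‖` at every scale `k`. -/
theorem growth_bound {X : Type*} [NormedAddCommGroup X] {f : ℂ → X} {u ε : ℕ → ℝ}
    (hε : ∀ k, 0 < ε k)
    (hu : ∀ n, 0 < u n) (huε : ∀ k n : ℕ, u n ≤ k + 1 + ε k * √n) {c : ℝ} (hc : 0 < c)
    (hf : ∀ᶠ n : ℕ in atTop, ∀ z : ℂ, ‖z‖ < 1 → ‖z‖ ^ n * u n ≤ c → ‖f z‖ ≤ u n / c) :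
    ∃ s₀ > 0, ∀ z : ℂ, ‖z‖ < 1 → 1 - ‖z‖ < s₀ → ∀ k : ℕ,
      (1 - ‖z‖) * ‖f z‖ ≤ ((1 - ‖z‖) * (k + 1) + 2 * ε k) / c := by
  obtain ⟨N, hN⟩ := eventually_atTop.1 hf
  have hlim : Tendsto (fun t : ℝ => Real.exp (-t) * (1 + ε 0 * (2 * t))) atTop (𝓝 0) := by
    have h1 : Tendsto (fun t : ℝ => Real.exp (-t)) atTop (𝓝 0) :=
      Real.tendsto_exp_neg_atTop_nhds_zero
    have h2 : Tendsto (fun t : ℝ => t ^ 1 * Real.exp (-t)) atTop (𝓝 0) :=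
      Real.tendsto_pow_mul_exp_neg_atTop_nhds_zero 1
    have h3 := h1.add (h2.const_mul (2 * ε 0))
    simp only [mul_zero, add_zero] at h3
    refine h3.congr fun t => ?_
    ring
  obtain ⟨t₀, ht₀⟩ := eventually_atTop.1
    ((hlim.eventually (gt_mem_nhds hc)).and
      ((eventually_ge_atTop (1 : ℝ)).and (eventually_ge_atTop (N : ℝ))))
  have ht₀1 : 1 ≤ t₀ := (ht₀ t₀ le_rfl).2.1
  refine ⟨1 / t₀, by positivity, fun z hz hzs k => ?_⟩
  set s := 1 - ‖z‖ with hs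
  have hs0 : 0 < s := by linarith
  set t := 1 / s with ht
  have hst : s * t = 1 := by rw [ht]; field_simp
  have htt₀ : t₀ ≤ t := by
    rw [ht, le_div_iff₀ hs0]
    rw [lt_div_iff₀ (by linarith)] at hzs
    linarith
  obtain ⟨hexp, ht1, htN⟩ := ht₀ t htt₀
  set n := ⌈t ^ 2⌉₊ with hn
  have hn1 : t ^ 2 ≤ n := Nat.le_ceil _
  have hn2 : (n : ℝ) < t ^ 2 + 1 := Nat.ceil_lt_add_one (by positivity)
  have hsqrt : √(n : ℝ) ≤ 2 * t := by
    rw [Real.sqrt_le_left (by linarith)]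
    nlinarith
  have hNn : N ≤ n := by
    have : (N : ℝ) ≤ n := by nlinarith
    exact_mod_cast this
  have hu2 : ∀ k : ℕ, u n ≤ k + 1 + ε k * (2 * t) := fun k =>
    (huε k n).trans (by have := hε k; gcongr)
  have hpow : ‖z‖ ^ n ≤ Real.exp (-t) := by
    have h1 : ‖z‖ ≤ Real.exp (-s) := by
      have := Real.add_one_le_exp (-s)
      linarith
    calc ‖z‖ ^ n ≤ Real.exp (-s) ^ n := by gcongr
      _ = Real.exp (-(n * s)) := by rw [← Real.exp_nat_mul]; ring_nf
      _ ≤ Real.exp (-t) := by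
        apply Real.exp_le_exp.2
        have : t ^ 2 * s ≤ n * s := by gcongr
        have h3 : t ^ 2 * s = t := by rw [pow_two, mul_assoc, mul_comm t s, hst, mul_one]
        linarith
  -- `u n` is polynomial in `t = 1 / s` (bound of index `0`) and `‖z‖ ^ n` is exponentially small.
  have hcn : ‖z‖ ^ n * u n ≤ c := by
    refine le_trans ?_ hexp.le
    have h0 := hu2 0
    simp only [Nat.cast_zero, zero_add] at h0
    exact mul_le_mul hpow h0 (hu n).le (Real.exp_pos _).le
  calc s * ‖f z‖ ≤ s * (u n / c) := by gcongr; exact hN n hNn z hz hcn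
    _ ≤ s * ((k + 1 + ε k * (2 * t)) / c) := by gcongr; exact hu2 k
    _ = (s * (k + 1) + 2 * ε k * (s * t)) / c := by ring
    _ = _ := by rw [hst, mul_one]

/-! ### Bounds near the circle in terms of the distance to the singular set -/

/-- If `|‖z‖² - 1| * ‖f z‖ ≤ C` on a circle of centre `a` and radius `d`, then
`‖a‖ * ‖f a‖ * d ≤ C`. On that circle `|‖z‖² - 1|` is, up to the factor `d`, the modulus of a
quadratic polynomial in `z`, and the maximum principle applies to the product of `f` with it. -/
theorem mul_norm_le_of_weighted_sphere_bound {X : Type*} [NormedAddCommGroup X] [NormedSpace ℂ X]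
    {f : ℂ → X} {a : ℂ} {d C : ℝ} (hd : 0 < d)
    (hf : DifferentiableOn ℂ f (Metric.closedBall a d))
    (hC : ∀ z ∈ Metric.sphere a d, |‖z‖ ^ 2 - 1| * ‖f z‖ ≤ C) :
    ‖a‖ * ‖f a‖ * d ≤ C := by
  set Q : ℂ → ℂ := fun z => starRingEnd ℂ a * (z - a) ^ 2
    + ((‖a‖ ^ 2 + d ^ 2 - 1 : ℝ) : ℂ) * (z - a) + a * (d : ℂ) ^ 2 with hQ
  have hQs : ∀ z ∈ Metric.sphere a d, ‖Q z‖ = d * |‖z‖ ^ 2 - 1| := by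
    -- `Q z = (z - a) (‖z‖² - 1)` there, since `d² = (z - a) * conj (z - a)`.
    intro z hz
    have hzd : ‖z - a‖ = d := by simpa [dist_eq_norm] using hz
    have h1 : ((d : ℝ) : ℂ) ^ 2 = (z - a) * starRingEnd ℂ (z - a) := by
      rw [Complex.mul_conj', hzd]
    have h2 : Q z = (z - a) * ((‖z‖ ^ 2 - 1 : ℝ) : ℂ) := by
      have hz2 : ((‖z‖ : ℝ) : ℂ) ^ 2 = z * starRingEnd ℂ z := (Complex.mul_conj' z).symm
      have ha2 : ((‖a‖ : ℝ) : ℂ) ^ 2 = a * starRingEnd ℂ a := (Complex.mul_conj' a).symm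
      simp only [hQ]
      push_cast
      rw [h1, hz2, ha2, map_sub]
      ring
    rw [h2, norm_mul, hzd, Complex.norm_real, Real.norm_eq_abs]
  have hdiff : DifferentiableOn ℂ (fun z => Q z • f z) (Metric.closedBall a d) := by
    refine DifferentiableOn.smul (Differentiable.differentiableOn ?_) hf
    simp only [hQ]
    fun_prop
  have hcc : DiffContOnCl ℂ (fun z => Q z • f z) (Metric.ball a d) := by
    apply DifferentiableOn.diffContOnCl
    rwa [closure_ball a hd.ne']
  have key := Complex.norm_le_of_forall_mem_frontier_norm_le (C := d * C) Metric.isBounded_ball hcc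
    (fun z hz => by
      have hz' := Metric.frontier_ball_subset_sphere hz
      rw [norm_smul, hQs z hz', mul_assoc]
      exact mul_le_mul_of_nonneg_left (hC z hz') hd.le)
    (subset_closure (Metric.mem_ball_self hd))
  have hQa : ‖Q a‖ = ‖a‖ * d ^ 2 := by
    simp [hQ]
  rw [norm_smul, hQa] at key
  nlinarith

/-- Growth controlled by the distance to the circle improves to growth controlled by the distance
`ρ` to the singular set `E`. -/
theorem norm_le_of_infDist_eq {X : Type*} [NormedAddCommGroup X] [NormedSpace ℂ X]
    {E : Set ℂ} (hsub : E ⊆ Metric.sphere (0 : ℂ) 1) (hcl : IsClosed E) (hne : E.Nonempty)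
    {f : ℂ → X} (hf : DifferentiableOn ℂ f Eᶜ)
    (hout : ∀ z, 1 ≤ ‖z‖ → z ∉ E → ‖f z‖ ≤ 1)
    {c s₀ ρ κ : ℝ} (hc : 0 < c) (hρ : 0 < ρ) (hρ2 : ρ ≤ 1 / 2) (hs₀ : 3 / 2 * ρ < s₀) (hκ : 1 ≤ κ)
    (hg : ∀ z : ℂ, ‖z‖ < 1 → 1 - ‖z‖ < s₀ →
      (1 - ‖z‖) * ‖f z‖ ≤ ((1 - ‖z‖) * κ + 2 * ρ) / c)
    {a : ℂ} (ha : ‖a‖ < 1) (haE : Metric.infDist a E = ρ) :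
    ‖f a‖ ≤ 18 + 32 * κ / c := by
  obtain ⟨e, heE, he⟩ := (Metric.isCompact_of_isClosed_isBounded hcl
    (Metric.isBounded_sphere.subset hsub)).exists_infDist_eq_dist hne a
  have he1 : ‖e‖ = 1 := by simpa using hsub heE
  have hea : ‖e - a‖ = ρ := by rw [← haE, he, dist_comm, dist_eq_norm]
  have hamin : 1 - ρ ≤ ‖a‖ := by
    have := norm_sub_norm_le e a
    linarith
  have hball : Metric.closedBall a (ρ / 2) ⊆ Eᶜ := by
    intro z hz hzE
    have h1 := Metric.infDist_le_dist_of_mem (x := a) hzE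
    rw [Metric.mem_closedBall, dist_comm] at hz
    linarith
  have key := mul_norm_le_of_weighted_sphere_bound (f := f) (a := a) (d := ρ / 2)
    (C := (9 + 16 * κ / c) * (ρ / 2)) (by positivity) (hf.mono hball) (fun z hz => by
      have hzE : z ∉ E := hball (Metric.sphere_subset_closedBall hz)
      have hza : ‖z - a‖ = ρ / 2 := by simpa [dist_eq_norm] using hz
      have h1 : ‖a‖ - ‖z‖ ≤ ρ / 2 := by
        have := norm_sub_norm_le a z
        rw [norm_sub_rev] at this
        linarith
      have h2 : ‖z‖ - ‖a‖ ≤ ρ / 2 := by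
        have := norm_sub_norm_le z a
        linarith
      have hf0 := norm_nonneg (f z)
      have hz0 := norm_nonneg z
      have hκc : 0 ≤ κ / c := by positivity
      -- On the circle of radius `ρ / 2` about `a` one has `|1 - ‖z‖| ≤ 3 ρ / 2`.
      rcases lt_or_ge ‖z‖ 1 with hz1 | hz1
      · have h3 := hg z hz1 (by linarith)
        rw [abs_of_nonpos (by nlinarith)]
        have h4 : -(‖z‖ ^ 2 - 1) * ‖f z‖ ≤ 2 * ((1 - ‖z‖) * ‖f z‖) := by
          have h5 : 0 ≤ (1 - ‖z‖) * ‖f z‖ := mul_nonneg (by linarith) hf0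
          nlinarith
        have h6 : ((1 - ‖z‖) * κ + 2 * ρ) / c ≤ (4 * ρ * κ) / c := by
          gcongr
          nlinarith
        have h7 : (4 * ρ * κ) / c = 4 * ρ * (κ / c) := by ring
        have h8 : (9 + 16 * κ / c) * (ρ / 2) = 9 * (ρ / 2) + 8 * ρ * (κ / c) := by ring
        rw [h8]
        linarith
      · have h3 := hout z hz1 hzE
        rw [abs_of_nonneg (by nlinarith)]
        have h4 : (‖z‖ ^ 2 - 1) * ‖f z‖ ≤ (‖z‖ ^ 2 - 1) := by
          have : 0 ≤ ‖z‖ ^ 2 - 1 := by nlinarith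
          nlinarith
        have h8 : (9 + 16 * κ / c) * (ρ / 2) = 9 * (ρ / 2) + 8 * ρ * (κ / c) := by ring
        have h9 : 0 ≤ 8 * ρ * (κ / c) := by positivity
        rw [h8]
        nlinarith)
  have h1 : ‖a‖ * ‖f a‖ ≤ 9 + 16 * κ / c := le_of_mul_le_mul_right key (by positivity)
  have h2 : 1 / 2 * ‖f a‖ ≤ ‖a‖ * ‖f a‖ := by
    gcongr
    linarith
  have h3 : 18 + 32 * κ / c = 2 * (9 + 16 * κ / c) := by ring
  rw [h3]
  linarith

/-! ### A Phragmén–Lindelöf principle -/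

/-- A rational function with nonnegative real part in the closed disk, whose real part is at least
`1 / 4` on every disk of radius `r` centred at a point of `A`, and which is of size `O(|A| r)` on
compact subsets of the open disk. -/
noncomputable def barrier (A : Finset ℂ) (r : ℝ) (z : ℂ) : ℂ :=
  ∑ a ∈ A, (r : ℂ) / (r + 1 - z * starRingEnd ℂ a)

section Barrier

variable {a z : ℂ} {r : ℝ}

theorem re_mul_conj_le (ha : ‖a‖ = 1) : (z * starRingEnd ℂ a).re ≤ ‖z‖ := by
  refine (Complex.re_le_norm _).trans ?_
  rw [norm_mul, Complex.norm_conj, ha, mul_one]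

theorem barrier_denom_ne_zero (ha : ‖a‖ = 1) (hz : ‖z‖ ≤ 1) (hr : 0 < r) :
    (r + 1 - z * starRingEnd ℂ a : ℂ) ≠ 0 := by
  intro h
  have h1 := congrArg Complex.re h
  have h2 := re_mul_conj_le (z := z) ha
  simp only [Complex.sub_re, Complex.add_re, Complex.ofReal_re, Complex.one_re,
    Complex.zero_re] at h1
  linarith

theorem barrier_term_re (ha : ‖a‖ = 1) (hz : ‖z‖ ≤ 1) (hr : 0 < r) :
    0 ≤ ((r : ℂ) / (r + 1 - z * starRingEnd ℂ a)).re := by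
  have h2 := re_mul_conj_le (z := z) ha
  rw [Complex.div_re]
  simp only [Complex.sub_re, Complex.add_re, Complex.ofReal_re, Complex.one_re, Complex.ofReal_im,
    zero_mul, zero_div, add_zero]
  apply div_nonneg (mul_nonneg hr.le (by linarith)) (Complex.normSq_nonneg _)

theorem barrier_term_re_ge (ha : ‖a‖ = 1) (hz : ‖z‖ ≤ 1) (hr : 0 < r) (hza : ‖z - a‖ ≤ r) :
    1 / 4 ≤ ((r : ℂ) / (r + 1 - z * starRingEnd ℂ a)).re := by
  have h2 := re_mul_conj_le (z := z) ha
  have hw : ‖1 - z * starRingEnd ℂ a‖ ≤ r := by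
    have h3 : 1 - z * starRingEnd ℂ a = (a - z) * starRingEnd ℂ a := by
      rw [sub_mul, Complex.mul_conj', ha]
      simp
    rw [h3, norm_mul, Complex.norm_conj, ha, mul_one, norm_sub_rev]
    exact hza
  set w := 1 - z * starRingEnd ℂ a with hwdef
  have hden : (r + 1 - z * starRingEnd ℂ a : ℂ) = r + w := by rw [hwdef]; ring
  have hwre : 0 ≤ w.re := by
    simp only [hwdef, Complex.sub_re, Complex.one_re]
    linarith
  have hns : Complex.normSq w ≤ r ^ 2 := by
    rw [Complex.normSq_eq_norm_sq]
    gcongr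
  rw [Complex.normSq_apply] at hns
  rw [hden, Complex.div_re, Complex.normSq_apply]
  simp only [Complex.add_re, Complex.add_im, Complex.ofReal_re, Complex.ofReal_im,
    zero_mul, zero_div, add_zero, zero_add]
  rw [div_le_div_iff₀ (by norm_num) (by nlinarith [mul_self_nonneg w.im])]
  nlinarith

theorem norm_barrier_term_le (ha : ‖a‖ = 1) (hz : ‖z‖ < 1) (hr : 0 < r) :
    ‖(r : ℂ) / (r + 1 - z * starRingEnd ℂ a)‖ ≤ r / (1 - ‖z‖) := by
  have h2 := re_mul_conj_le (z := z) ha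
  have h3 := Complex.re_le_norm (r + 1 - z * starRingEnd ℂ a : ℂ)
  simp only [Complex.sub_re, Complex.add_re, Complex.ofReal_re, Complex.one_re] at h3
  rw [norm_div, Complex.norm_real, Real.norm_eq_abs, abs_of_pos hr]
  apply div_le_div_of_nonneg_left hr.le (by linarith) (by linarith)

end Barrier

theorem barrier_re_nonneg {A : Finset ℂ} (hA : ∀ a ∈ A, ‖a‖ = 1) {r : ℝ} (hr : 0 < r) {z : ℂ}
    (hz : ‖z‖ ≤ 1) : 0 ≤ (barrier A r z).re := by
  rw [barrier, Complex.re_sum]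
  exact Finset.sum_nonneg fun a ha => barrier_term_re (hA a ha) hz hr

theorem barrier_re_ge {A : Finset ℂ} (hA : ∀ a ∈ A, ‖a‖ = 1) {r : ℝ} (hr : 0 < r) {z : ℂ}
    (hz : ‖z‖ ≤ 1) (h : ∃ a ∈ A, ‖z - a‖ ≤ r) : 1 / 4 ≤ (barrier A r z).re := by
  obtain ⟨a, ha, hza⟩ := h
  rw [barrier, Complex.re_sum]
  exact (barrier_term_re_ge (hA a ha) hz hr hza).trans
    (Finset.single_le_sum (f := fun a => ((r : ℂ) / (r + 1 - z * starRingEnd ℂ a)).re)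
      (fun b hb => barrier_term_re (hA b hb) hz hr) ha)

theorem norm_barrier_le {A : Finset ℂ} (hA : ∀ a ∈ A, ‖a‖ = 1) {r : ℝ} (hr : 0 < r) {z : ℂ}
    (hz : ‖z‖ < 1) : ‖barrier A r z‖ ≤ A.card * r / (1 - ‖z‖) := by
  refine (norm_sum_le_of_le A fun a ha => norm_barrier_term_le (hA a ha) hz hr).trans_eq ?_
  rw [Finset.sum_const, nsmul_eq_mul, mul_div_assoc]

theorem differentiableOn_barrier {A : Finset ℂ} (hA : ∀ a ∈ A, ‖a‖ = 1) {r : ℝ} (hr : 0 < r) :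
    DifferentiableOn ℂ (barrier A r) (Metric.closedBall 0 1) := by
  unfold barrier
  refine DifferentiableOn.fun_sum fun a ha => ?_
  refine DifferentiableOn.div (by fun_prop) (by fun_prop) fun z hz => ?_
  exact barrier_denom_ne_zero (hA a ha) (by simpa using hz) hr

/-- The maximum principle for `exp (-M * barrier) • f` on the part of the disk at distance more
than `ρ` from `E`. -/
theorem norm_le_exp_of_infDist_lt {X : Type*} [NormedAddCommGroup X] [NormedSpace ℂ X]
    {E : Set ℂ} (hsub : E ⊆ Metric.sphere (0 : ℂ) 1) (hcl : IsClosed E) (hne : E.Nonempty)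
    {f : ℂ → X} (hf : DifferentiableOn ℂ f Eᶜ)
    (hout : ∀ z, ‖z‖ = 1 → z ∉ E → ‖f z‖ ≤ 1)
    {A : Finset ℂ} (hA : ∀ a ∈ A, ‖a‖ = 1) {ρ M : ℝ} (hρ : 0 < ρ) (hM : 0 ≤ M)
    (hcov : ∀ z ∈ E, ∃ a ∈ A, ‖z - a‖ ≤ ρ)
    (hB : ∀ z, ‖z‖ < 1 → Metric.infDist z E = ρ → ‖f z‖ ≤ Real.exp (M / 4))
    {z : ℂ} (hz : ‖z‖ < 1) (hzE : ρ < Metric.infDist z E) :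
    ‖f z‖ ≤ Real.exp (M * (A.card * (2 * ρ) / (1 - ‖z‖))) := by
  set U : Set ℂ := {w | ‖w‖ < 1} ∩ {w | ρ < Metric.infDist w E} with hU
  have hUo : IsOpen U := (isOpen_lt continuous_norm continuous_const).inter
    (isOpen_lt continuous_const (Metric.continuous_infDist_pt E))
  have hUcl : closure U ⊆ {w | ‖w‖ ≤ 1} ∩ {w | ρ ≤ Metric.infDist w E} :=
    closure_minimal (fun w hw =>
      ⟨(show ‖w‖ < 1 from hw.1).le, (show ρ < Metric.infDist w E from hw.2).le⟩)
      ((isClosed_le continuous_norm continuous_const).inter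
        (isClosed_le continuous_const (Metric.continuous_infDist_pt E)))
  have hclE : ∀ w ∈ closure U, w ∉ E := by
    intro w hw hwE
    have h1 := (hUcl hw).2
    simp only [mem_ofPred_eq, Metric.infDist_zero_of_mem hwE] at h1
    linarith
  have hUb : Bornology.IsBounded U :=
    Metric.isBounded_closedBall.subset (s := U) (t := Metric.closedBall 0 1)
      fun w hw => by simpa using le_of_lt hw.1
  set g : ℂ → X := fun w => Complex.exp (-(M * barrier A (2 * ρ) w)) • f w with hg
  have hr : 0 < 2 * ρ := by positivity
  have hgd : DiffContOnCl ℂ g U := by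
    apply DifferentiableOn.diffContOnCl
    refine DifferentiableOn.smul ?_ (hf.mono hclE)
    refine DifferentiableOn.cexp (((differentiableOn_barrier hA hr).mono ?_).const_mul _).neg
    intro w hw
    simpa using (hUcl hw).1
  have hnorm : ∀ w, ‖g w‖ = Real.exp (-(M * (barrier A (2 * ρ) w).re)) * ‖f w‖ := by
    intro w
    simp only [hg, norm_smul, Complex.norm_exp]
    simp
  have key := Complex.norm_le_of_forall_mem_frontier_norm_le (C := 1) hUb hgd (fun w hw => by
    have hwcl := frontier_subset_closure hw
    obtain ⟨hw1, hw2⟩ := hUcl hwcl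
    simp only [mem_ofPred_eq] at hw1 hw2
    have hre := barrier_re_nonneg hA hr hw1
    rw [hnorm]
    rcases hw1.eq_or_lt with hw1' | hw1'
    · have h1 := hout w hw1' (hclE w hwcl)
      have h2 : Real.exp (-(M * (barrier A (2 * ρ) w).re)) ≤ 1 :=
        Real.exp_le_one_iff.2 (neg_nonpos.2 (mul_nonneg hM hre))
      exact mul_le_one₀ h2 (norm_nonneg _) h1
    · have hwρ : Metric.infDist w E = ρ := by
        refine le_antisymm (not_lt.1 fun h => ?_) hw2
        rw [hUo.frontier_eq] at hw
        exact hw.2 ⟨hw1', h⟩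
      obtain ⟨e, heE, he⟩ := (Metric.isCompact_of_isClosed_isBounded hcl
        (Metric.isBounded_sphere.subset hsub)).exists_infDist_eq_dist hne w
      obtain ⟨a, ha, hea⟩ := hcov e heE
      have hwa : ‖w - a‖ ≤ 2 * ρ := by
        have h3 := norm_sub_le_norm_sub_add_norm_sub w e a
        rw [hwρ, dist_eq_norm] at he
        linarith
      have hre4 := barrier_re_ge hA hr hw1 ⟨a, ha, hwa⟩
      calc Real.exp (-(M * (barrier A (2 * ρ) w).re)) * ‖f w‖
          ≤ Real.exp (-(M * (1 / 4))) * Real.exp (M / 4) := by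
            gcongr
            exact hB w hw1' hwρ
        _ = 1 := by
            rw [← Real.exp_add, Real.exp_eq_one_iff]
            ring) (subset_closure (show z ∈ U from ⟨hz, hzE⟩))
  rw [hnorm, Real.exp_neg, inv_mul_le_iff₀ (Real.exp_pos _), mul_one] at key
  refine key.trans (Real.exp_le_exp.2 (mul_le_mul_of_nonneg_left ?_ hM))
  exact (Complex.re_le_norm _).trans (norm_barrier_le hA hr hz)

/-- A function holomorphic off `E`, bounded by `1` off the open disk, and growing sufficiently
slowly at the circle inside the disk, is bounded by `1` everywhere. -/
theorem norm_le_one_of_slow_growth {X : Type*} [NormedAddCommGroup X] [NormedSpace ℂ X]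
    {E : Set ℂ} (hsub : E ⊆ Metric.sphere (0 : ℂ) 1) (hcl : IsClosed E)
    {f : ℂ → X} (hf : DifferentiableOn ℂ f Eᶜ)
    (hout : ∀ z, 1 ≤ ‖z‖ → z ∉ E → ‖f z‖ ≤ 1)
    {A : ℕ → Finset ℂ} (hA : ∀ k, ∀ a ∈ A k, ‖a‖ = 1) {ρ : ℕ → ℝ} (hρ : ∀ k, 0 < ρ k)
    (hρle : ∀ k : ℕ, ρ k ≤ 1 / ((k : ℝ) + 1) ^ 2)
    (hcard : ∀ k : ℕ, (A k).card * ρ k ≤ 1 / ((k : ℝ) + 1) ^ 2)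
    (hcov : ∀ k, ∀ z ∈ E, ∃ a ∈ A k, ‖z - a‖ ≤ ρ k)
    {c s₀ : ℝ} (hc : 0 < c) (hs₀ : 0 < s₀)
    (hg : ∀ z : ℂ, ‖z‖ < 1 → 1 - ‖z‖ < s₀ → ∀ k : ℕ,
      (1 - ‖z‖) * ‖f z‖ ≤ ((1 - ‖z‖) * (k + 1) + 2 * ρ k) / c)
    {z : ℂ} (hz : ‖z‖ < 1) : ‖f z‖ ≤ 1 := by
  rcases E.eq_empty_or_nonempty with rfl | hne
  · refine Complex.norm_le_of_forall_mem_frontier_norm_le (U := Metric.ball 0 1)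
      Metric.isBounded_ball (hf.mono fun w _ => by simp).diffContOnCl (fun w hw => ?_)
      (subset_closure (by simpa using hz))
    have := Metric.frontier_ball_subset_sphere hw
    exact hout w (by simpa using (mem_sphere_zero_iff_norm.1 this).ge) (by simp)
  have hzE : 0 < Metric.infDist z E := by
    refine (hcl.notMem_iff_infDist_pos hne).1 fun h => ?_
    have : ‖z‖ = 1 := by simpa using hsub h
    linarith
  have hinv : Tendsto (fun k : ℕ => 1 / ((k : ℝ) + 1)) atTop (𝓝 0) :=
    tendsto_one_div_add_atTop_nhds_zero_nat
  have hinv2 : Tendsto (fun k : ℕ => 1 / ((k : ℝ) + 1) ^ 2) atTop (𝓝 0) := by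
    have := hinv.pow 2
    simpa [div_pow] using this
  have hρ0 : Tendsto ρ atTop (𝓝 0) :=
    squeeze_zero (fun k => (hρ k).le) hρle hinv2
  -- The bound on `f` at distance `ρ k` from `E` is linear in `k`, the barrier allows `exp (k / 4)`.
  have hexp : ∀ᶠ k : ℕ in atTop, 18 + 32 * ((k : ℝ) + 1) / c ≤ Real.exp ((k : ℝ) / 4) := by
    have h1 : Tendsto (fun x : ℝ => Real.exp x / x ^ 1) atTop atTop :=
      Real.tendsto_exp_div_pow_atTop 1
    have h2 : Tendsto (fun k : ℕ => (k : ℝ) / 4) atTop atTop :=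
      tendsto_natCast_atTop_atTop.atTop_div_const (by norm_num)
    filter_upwards [(h1.comp h2).eventually_ge_atTop (4 * (18 + 64 / c)), eventually_ge_atTop 1]
      with k hk hk1
    have hk1' : (1 : ℝ) ≤ k := by exact_mod_cast hk1
    simp only [Function.comp, pow_one] at hk
    rw [le_div_iff₀ (by positivity)] at hk
    refine le_trans ?_ hk
    have h3 : 32 * ((k : ℝ) + 1) / c ≤ 64 / c * k := by
      rw [div_mul_eq_mul_div]
      gcongr ?_ / c
      linarith
    nlinarith
  have hbound : ∀ᶠ k : ℕ in atTop,
      ‖f z‖ ≤ Real.exp (2 / (1 - ‖z‖) * (1 / ((k : ℝ) + 1))) := by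
    filter_upwards [hexp, hρ0.eventually (gt_mem_nhds (show (0 : ℝ) < 1 / 2 by norm_num)),
      hρ0.eventually (gt_mem_nhds (show 0 < 2 / 3 * s₀ by positivity)),
      hρ0.eventually (gt_mem_nhds hzE)] with k hk1 hk2 hk3 hk4
    have h1 := norm_le_exp_of_infDist_lt hsub hcl hne hf (fun w hw => hout w hw.ge) (hA k) (hρ k)
      (Nat.cast_nonneg k) (hcov k) (fun w hw hwE =>
        (norm_le_of_infDist_eq hsub hcl hne hf hout hc (hρ k) hk2.le (by linarith)
          (κ := (k : ℝ) + 1) (by linarith [Nat.cast_nonneg (α := ℝ) k])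
          (fun v hv hvs => hg v hv hvs k) hw hwE).trans hk1) hz hk4
    refine h1.trans (Real.exp_le_exp.2 ?_)
    have h1z : 0 < 1 - ‖z‖ := by linarith
    have hkp : (0 : ℝ) < (k : ℝ) + 1 := by positivity
    calc (k : ℝ) * ((A k).card * (2 * ρ k) / (1 - ‖z‖))
        = 2 / (1 - ‖z‖) * (k * ((A k).card * ρ k)) := by ring
      _ ≤ 2 / (1 - ‖z‖) * (k * (1 / ((k : ℝ) + 1) ^ 2)) := by
          gcongr
          exact hcard k
      _ ≤ 2 / (1 - ‖z‖) * (((k : ℝ) + 1) * (1 / ((k : ℝ) + 1) ^ 2)) := by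
          gcongr
          linarith
      _ = _ := by
          field_simp
  refine ge_of_tendsto ?_ hbound
  have := (hinv.const_mul (2 / (1 - ‖z‖))).rexp
  simpa using this

/-! ### Bounds on operators and on `delta` -/

section Operators

variable {F F' : Type*} [NormedAddCommGroup F] [InnerProductSpace ℂ F]
  [NormedAddCommGroup F'] [InnerProductSpace ℂ F']

theorem norm_le_one_of_purelyContractive {T : F →L[ℂ] F'} (hT : PurelyContractive T) :
    ‖T‖ ≤ 1 := by
  refine T.opNorm_le_bound zero_le_one fun x => ?_
  rw [one_mul]
  rcases eq_or_ne x 0 with rfl | hx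
  · simp
  · exact (hT x hx).le

theorem delta_nonneg (Θ : OnePoint ℂ → F →L[ℂ] F') (n : ℕ) : 0 ≤ delta Θ n :=
  Real.iInf_nonneg fun _ => le_max_of_le_left (by positivity)

theorem delta_le (Θ : OnePoint ℂ → F →L[ℂ] F') (n : ℕ) {z : ℂ} (hz : ‖z‖ < 1) :
    delta Θ n ≤ max (‖z‖ ^ n) ‖ContinuousLinearMap.inverse (Θ (z : OnePoint ℂ))‖⁻¹ := by
  refine ciInf_le (f := fun z : Metric.ball (0 : ℂ) 1 => max (‖(z : ℂ)‖ ^ n)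
    ‖ContinuousLinearMap.inverse (Θ ((z : ℂ) : OnePoint ℂ))‖⁻¹) ⟨0, ?_⟩ ⟨z, by simpa using hz⟩
  rintro _ ⟨w, rfl⟩
  exact le_max_of_le_left (by positivity)

/-- A lower bound for `delta Θ n` bounds `Θ(z)⁻¹` where `|z| ^ n` is small. -/
theorem norm_inverse_le_of_lt_mul_delta {Θ : OnePoint ℂ → F →L[ℂ] F'} {n : ℕ} {v c : ℝ}
    (hv : 0 < v) (hc : 0 < c) (h : c < v * delta Θ n) {z : ℂ} (hz : ‖z‖ < 1)
    (hzn : ‖z‖ ^ n * v ≤ c) :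
    ‖ContinuousLinearMap.inverse (Θ (z : OnePoint ℂ))‖ ≤ v / c := by
  have h1 : c / v < delta Θ n := by
    rw [div_lt_iff₀ hv]
    linarith
  have h2 : ‖z‖ ^ n ≤ c / v := by rwa [le_div_iff₀ hv]
  rcases lt_max_iff.1 (h1.trans_le (delta_le Θ n hz)) with h3 | h3
  · linarith
  · have hpos : 0 < ‖ContinuousLinearMap.inverse (Θ (z : OnePoint ℂ))‖ :=
      inv_pos.1 ((div_pos hc hv).trans h3)
    have h4 := (lt_inv_comm₀ (div_pos hc hv) hpos).1 h3
    rw [inv_div] at h4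
    exact h4.le

variable [CompleteSpace F] [CompleteSpace F']

theorem norm_le_one_of_isUnitaryOp {T : F →L[ℂ] F'} (hT : IsUnitaryOp T) : ‖T‖ ≤ 1 := by
  have h1 : ‖T‖ * ‖T‖ ≤ 1 := by
    rw [← ContinuousLinearMap.norm_adjoint_comp_self, hT.1]
    exact ContinuousLinearMap.norm_id_le
  nlinarith [norm_nonneg T]

end Operators

/-! ### Reflection in the circle -/

/-- Identity theorem across a free arc: a function holomorphic off `E` that vanishes on
`𝕋 \ E ≠ ∅` vanishes in the disk. -/
theorem eq_zero_of_eq_zero_on_sphere {X : Type*} [NormedAddCommGroup X] [NormedSpace ℂ X]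
    [CompleteSpace X] {E : Set ℂ} (hsub : E ⊆ Metric.sphere (0 : ℂ) 1) (hcl : IsClosed E)
    {p : ℂ} (hp : ‖p‖ = 1) (hpE : p ∉ E) {H : ℂ → X} (hH : DifferentiableOn ℂ H Eᶜ)
    (h0 : ∀ z, ‖z‖ = 1 → z ∉ E → H z = 0) {z : ℂ} (hz : ‖z‖ < 1) : H z = 0 := by
  obtain ⟨r, hr, hrE⟩ := Metric.isOpen_iff.1 hcl.isOpen_compl p hpE
  have hballE : Metric.ball (0 : ℂ) 1 ⊆ Eᶜ := by
    intro w hw hwE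
    have h1 : ‖w‖ = 1 := by simpa using hsub hwE
    have h2 : ‖w‖ < 1 := by simpa using hw
    linarith
  have hmeet : (Metric.ball (0 : ℂ) 1 ∩ Metric.ball p r).Nonempty := by
    have hpcl : p ∈ closure (Metric.ball (0 : ℂ) 1) := by
      rw [closure_ball _ one_ne_zero]
      simp [hp]
    obtain ⟨w, hw, hwp⟩ := Metric.mem_closure_iff.1 hpcl r hr
    exact ⟨w, hw, by rwa [Metric.mem_ball, dist_comm]⟩
  obtain ⟨w, hw1, hw2⟩ := hmeet
  have hconn : IsPreconnected (Metric.ball (0 : ℂ) 1 ∪ Metric.ball p r) :=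
    IsPreconnected.union w hw1 hw2 (convex_ball 0 1).isPreconnected (convex_ball p r).isPreconnected
  have han : AnalyticOnNhd ℂ H (Metric.ball (0 : ℂ) 1 ∪ Metric.ball p r) :=
    (hH.mono (union_subset hballE hrE)).analyticOnNhd (Metric.isOpen_ball.union Metric.isOpen_ball)
  have hderiv : HasDerivAt (fun θ : ℝ => p * Complex.exp (θ * Complex.I)) (p * Complex.I) 0 := by
    have h1 : HasDerivAt (fun θ : ℝ => (θ : ℂ) * Complex.I) (1 * Complex.I) 0 :=
      (Complex.ofRealCLM.hasDerivAt (x := (0 : ℝ))).mul_const _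
    have h2 := (h1.cexp).const_mul p
    simpa using h2
  have htend : Tendsto (fun θ : ℝ => p * Complex.exp (θ * Complex.I)) (𝓝[≠] 0) (𝓝[≠] p) := by
    have hp0 : p ≠ 0 := by
      rintro rfl
      simp at hp
    have := hderiv.tendsto_nhdsNE (mul_ne_zero hp0 Complex.I_ne_zero)
    simpa using this
  have hfreq : ∃ᶠ w in 𝓝[≠] p, H w = 0 := by
    refine htend.frequently (Eventually.frequently ?_)
    have hE : ∀ᶠ w in 𝓝[≠] p, w ∉ E :=
      (hcl.isOpen_compl.eventually_mem hpE).filter_mono nhdsWithin_le_nhds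
    filter_upwards [htend.eventually hE] with θ hθ
    refine h0 _ ?_ hθ
    rw [norm_mul, hp, Complex.norm_exp_ofReal_mul_I, one_mul]
  exact han.eqOn_zero_of_preconnected_of_frequently_eq_zero hconn
    (Or.inr (Metric.mem_ball_self hr)) hfreq (Or.inl (by simpa using hz))

section Operators

variable {F F' : Type*} [NormedAddCommGroup F] [InnerProductSpace ℂ F] [CompleteSpace F]
  [NormedAddCommGroup F'] [InnerProductSpace ℂ F'] [CompleteSpace F']

/-- Conjugating the variable and taking the adjoint of the values preserves holomorphy. -/
theorem hasDerivAt_adjoint_conj {f : ℂ → F →L[ℂ] F'} {f' : F →L[ℂ] F'} {z : ℂ}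
    (hf : HasDerivAt f f' (starRingEnd ℂ z)) :
    HasDerivAt (fun w => ContinuousLinearMap.adjoint (f (starRingEnd ℂ w)))
      (ContinuousLinearMap.adjoint f') z := by
  rw [hasDerivAt_iff_isLittleO] at hf ⊢
  have hconj : Tendsto (starRingEnd ℂ) (𝓝 z) (𝓝 (starRingEnd ℂ z)) :=
    Complex.continuous_conj.tendsto z
  have h := hf.comp_tendsto hconj
  refine Asymptotics.IsLittleO.of_norm_norm ((h.norm_norm).congr (fun w => ?_) fun w => ?_)
  · rw [Function.comp_apply, ← (ContinuousLinearMap.adjoint (𝕜 := ℂ) (E := F) (F := F')).norm_map]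
    simp only [map_sub, map_smulₛₗ, Complex.conj_conj]
  · rw [Function.comp_apply, ← map_sub, Complex.norm_conj]

/-- The reflection `z ↦ Θ(1 / z̄)*` of an operator function in the unit circle. It is written in
the coordinate at infinity, so that its value at `0` is `Θ(∞)*`. -/
noncomputable def reflection (Θ : OnePoint ℂ → F →L[ℂ] F') (z : ℂ) : F' →L[ℂ] F :=
  ContinuousLinearMap.adjoint (Θ (chartInfty (starRingEnd ℂ z)))

theorem chartInfty_conj_of_ne_zero {z : ℂ} (hz : z ≠ 0) :
    chartInfty (starRingEnd ℂ z) = (((starRingEnd ℂ z)⁻¹ : ℂ) : OnePoint ℂ) := by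
  rw [chartInfty, if_neg ((map_ne_zero _).2 hz)]

theorem inv_conj_of_norm_eq_one {z : ℂ} (hz : ‖z‖ = 1) : (starRingEnd ℂ z)⁻¹ = z := by
  have h : z * starRingEnd ℂ z = 1 := by
    rw [Complex.mul_conj', hz]
    simp
  exact inv_eq_of_mul_eq_one_left h

theorem reflection_of_norm_eq_one (Θ : OnePoint ℂ → F →L[ℂ] F') {z : ℂ} (hz : ‖z‖ = 1) :
    reflection Θ z = ContinuousLinearMap.adjoint (Θ (z : OnePoint ℂ)) := by
  have hz0 : z ≠ 0 := by
    rintro rfl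
    simp at hz
  rw [reflection, chartInfty_conj_of_ne_zero hz0, inv_conj_of_norm_eq_one hz]

theorem differentiableOn_reflection {E : Set ℂ} (hsub : E ⊆ Metric.sphere (0 : ℂ) 1)
    (hcl : IsClosed E) {Θ : OnePoint ℂ → F →L[ℂ] F'}
    (hΘ : HolomorphicOnSphere Θ ((fun z : ℂ => (z : OnePoint ℂ)) '' E)ᶜ) :
    DifferentiableOn ℂ (reflection Θ) Eᶜ := by
  have hmem : ∀ w : ℂ, starRingEnd ℂ w ∉ E →
      chartInfty w ∈ ((fun z : ℂ => (z : OnePoint ℂ)) '' E)ᶜ := by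
    rintro w hw ⟨e, he, hew⟩
    by_cases hw0 : w = 0
    · simp [chartInfty, hw0] at hew
    · simp only [chartInfty, if_neg hw0, OnePoint.coe_eq_coe] at hew
      have he1 : ‖e‖ = 1 := by simpa using hsub he
      have h1 : starRingEnd ℂ w = e := by
        rw [← inv_conj_of_norm_eq_one he1, hew]
        simp
      exact hw (h1 ▸ he)
  intro z hz
  have hopen : IsOpen {w : ℂ | starRingEnd ℂ w ∉ E} :=
    hcl.isOpen_compl.preimage Complex.continuous_conj
  have hd : DifferentiableAt ℂ (fun w : ℂ => Θ (chartInfty w)) (starRingEnd ℂ z) :=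
    (hΘ.2.mono hmem).differentiableAt (hopen.mem_nhds (by simpa using hz))
  exact (hasDerivAt_adjoint_conj hd.hasDerivAt).differentiableAt.differentiableWithinAt

/-- Off the open disk the reflection takes adjoints of values of `Θ` in the closed disk. -/
theorem norm_reflection_le_one {E : Set ℂ} {Θ : OnePoint ℂ → F →L[ℂ] F'}
    (hpure : ∀ z : ℂ, ‖z‖ < 1 → PurelyContractive (Θ (z : OnePoint ℂ)))
    (hunit : ∀ z : ℂ, ‖z‖ = 1 → z ∉ E → IsUnitaryOp (Θ (z : OnePoint ℂ)))
    {z : ℂ} (hz : 1 ≤ ‖z‖) (hzE : z ∉ E) : ‖reflection Θ z‖ ≤ 1 := by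
  rcases hz.eq_or_lt with h | h
  · rw [reflection_of_norm_eq_one Θ h.symm, LinearIsometryEquiv.norm_map]
    exact norm_le_one_of_isUnitaryOp (hunit z h.symm hzE)
  · have hz0 : z ≠ 0 := by
      rintro rfl
      simp at hz
      linarith
    rw [reflection, LinearIsometryEquiv.norm_map, chartInfty_conj_of_ne_zero hz0]
    refine norm_le_one_of_purelyContractive (hpure _ ?_)
    rw [norm_inv, Complex.norm_conj]
    exact inv_lt_one_of_one_lt₀ h

/-- The reflection principle: `Θ(1 / z̄)*` is a two-sided inverse of `Θ(z)` in the disk, because it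
is one on `𝕋 \ E`. -/
theorem reflection_comp_and_comp_reflection {E : Set ℂ} (hsub : E ⊆ Metric.sphere (0 : ℂ) 1)
    (hcl : IsClosed E) {p : ℂ} (hp : ‖p‖ = 1) (hpE : p ∉ E) {Θ : OnePoint ℂ → F →L[ℂ] F'}
    (hΘ : HolomorphicOnSphere Θ ((fun z : ℂ => (z : OnePoint ℂ)) '' E)ᶜ)
    (hunit : ∀ z : ℂ, ‖z‖ = 1 → z ∉ E → IsUnitaryOp (Θ (z : OnePoint ℂ)))
    {z : ℂ} (hz : ‖z‖ < 1) :
    Θ (z : OnePoint ℂ) ∘L reflection Θ z = .id ℂ F' ∧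
      reflection Θ z ∘L Θ (z : OnePoint ℂ) = .id ℂ F := by
  have hR := differentiableOn_reflection hsub hcl hΘ
  have hT : DifferentiableOn ℂ (fun z : ℂ => Θ (z : OnePoint ℂ)) Eᶜ := by
    refine hΘ.1.mono fun w hw => ?_
    rintro ⟨e, he, hew⟩
    exact hw (OnePoint.coe_injective hew ▸ he)
  constructor
  · exact sub_eq_zero.1 <| eq_zero_of_eq_zero_on_sphere hsub hcl hp hpE
      (H := fun w => Θ (w : OnePoint ℂ) ∘L reflection Θ w - .id ℂ F')
      ((hT.clm_comp hR).sub_const _)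
      (fun w hw hwE => by
        rw [reflection_of_norm_eq_one Θ hw, (hunit w hw hwE).2, sub_self]) hz
  · exact sub_eq_zero.1 <| eq_zero_of_eq_zero_on_sphere hsub hcl hp hpE
      (H := fun w => reflection Θ w ∘L Θ (w : OnePoint ℂ) - .id ℂ F)
      ((hR.clm_comp hT).sub_const _)
      (fun w hw hwE => by
        rw [reflection_of_norm_eq_one Θ hw, (hunit w hw hwE).1, sub_self]) hz

end Operators

end InnerFn

theorem theorem3p1 (E : Set ℂ) (hE_sub : E ⊆ Metric.sphere (0 : ℂ) 1) (hE_closed : IsClosed E)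
    (hE_null : InnerFn.circleLebesgue E = 0) :
    ∃ u : ℕ → ℝ, (∀ n, 0 < u n) ∧ Tendsto u atTop atTop ∧
      ∀ (F : Type*) (F' : Type*)
        [NormedAddCommGroup F] [InnerProductSpace ℂ F] [CompleteSpace F] [Nontrivial F]
        [NormedAddCommGroup F'] [InnerProductSpace ℂ F'] [CompleteSpace F']
        (Θ : OnePoint ℂ → F →L[ℂ] F'),
        InnerFn.HolomorphicOnSphere Θ ((fun z : ℂ => (z : OnePoint ℂ)) '' E)ᶜ →
        (∀ z : ℂ, ‖z‖ < 1 → InnerFn.PurelyContractive (Θ (z : OnePoint ℂ))) →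
        (∀ z : ℂ, ‖z‖ = 1 → z ∉ E → InnerFn.IsUnitaryOp (Θ (z : OnePoint ℂ))) →
        (∀ z : ℂ, ‖z‖ < 1 → (Θ (z : OnePoint ℂ)).IsInvertible) ∧
          liminf (fun n : ℕ => ((u n * InnerFn.delta Θ n : ℝ) : EReal)) atTop = 0 := by
  have hcontent := InnerFn.hasZeroContent_of_null hE_sub hE_closed hE_null
  obtain ⟨p, hp, hpE⟩ := InnerFn.exists_sphere_notMem_of_circleLebesgue_eq_zero hE_null
  choose ρ hρ hρle A hA hcard hcov using fun k : ℕ =>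
    hcontent (1 / ((k : ℝ) + 1) ^ 2) (by positivity)
  obtain ⟨u, hu, hu_top, huρ⟩ := InnerFn.exists_slow_sequence hρ
  refine ⟨u, hu, hu_top, ?_⟩
  intro F F' _ _ _ _ _ _ _ Θ hΘ hpure hunit
  have hinv : ∀ z : ℂ, ‖z‖ < 1 → Θ (z : OnePoint ℂ) ∘L InnerFn.reflection Θ z = .id ℂ F' ∧
      InnerFn.reflection Θ z ∘L Θ (z : OnePoint ℂ) = .id ℂ F := fun z hz =>
    InnerFn.reflection_comp_and_comp_reflection hE_sub hE_closed hp hpE hΘ hunit hz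
  refine ⟨fun z hz => .of_inverse (hinv z hz).1 (hinv z hz).2, le_antisymm ?_ ?_⟩
  · by_contra! hpos
    obtain ⟨c, hc0, hc⟩ := EReal.lt_iff_exists_real_btwn.1 hpos
    have hc0' : 0 < c := by exact_mod_cast hc0
    have hev : ∀ᶠ n : ℕ in atTop, ∀ z : ℂ, ‖z‖ < 1 → ‖z‖ ^ n * u n ≤ c →
        ‖InnerFn.reflection Θ z‖ ≤ u n / c := by
      filter_upwards [eventually_lt_of_lt_liminf hc] with n hn z hz hzn
      rw [← ContinuousLinearMap.inverse_eq (hinv z hz).1 (hinv z hz).2]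
      exact InnerFn.norm_inverse_le_of_lt_mul_delta (hu n) hc0' (EReal.coe_lt_coe_iff.1 hn) hz hzn
    obtain ⟨s₀, hs₀, hg⟩ := InnerFn.growth_bound hρ hu huρ hc0' hev
    have hle : ‖InnerFn.reflection Θ 0‖ ≤ 1 :=
      InnerFn.norm_le_one_of_slow_growth hE_sub hE_closed
        (InnerFn.differentiableOn_reflection hE_sub hE_closed hΘ)
        (fun z hz hzE => InnerFn.norm_reflection_le_one hpure hunit hz hzE)
        hA hρ hρle hcard hcov hc0' hs₀ hg (by simp)
    -- A contractive inverse would make `Θ 0` expansive, although it is purely contractive.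
    obtain ⟨x, hx⟩ := exists_ne (0 : F)
    have h0 : ‖(0 : ℂ)‖ < 1 := by simp
    have h1 : InnerFn.reflection Θ 0 (Θ ((0 : ℂ) : OnePoint ℂ) x) = x := by
      have := congrArg (fun T : F →L[ℂ] F => T x) (hinv 0 h0).2
      simpa using this
    have h2 := (InnerFn.reflection Θ 0).le_of_opNorm_le hle (Θ ((0 : ℂ) : OnePoint ℂ) x)
    rw [h1, one_mul] at h2
    exact absurd (hpure 0 h0 x hx) (not_lt.2 h2)
  · refine le_liminf_of_le (by isBoundedDefault) (Eventually.of_forall fun n => ?_)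
    exact_mod_cast mul_nonneg (hu n).le (InnerFn.delta_nonneg Θ n)
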